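/- Let $n\ge 1$, $\sigma>0$, $\mu\in\mathbb{R}^n$, let $K\subset\mathbb{R}^n$ be closed and convex, and let $u\in K$. Write $\|\cdot\|_2$ for the Euclidean norm and $\|v\|^2=\frac1n\sum_{i=1}^n v_i^2$ for the squared scaled norm. Let $\xi\sim\mathcal N(0,\sigma^2 I_{n\times n})$, $y=\mu+\xi$, and let $\hat\mu^{LS}(K)\in\operatorname{argmin}_{v\in K}\|y-v\|^2$ be the least squares estimator over $K$. Let $$T_{K,u}=\overline{\{t(v-u):\ t\ge 0,\ v\in K\}}$$ be the tangent cone of $K$ at $u$, and for a closed convex cone $L\subset\mathbb{R}^n$ let $\delta(L)=\mathbb E\big[\|\Pi_L(g)\|_2^2\big]$, $g\sim\mathcal N(0,I_{n\times n})$, be its statistical dimension, where $\Pi_L$ is the Euclidean projection onto $L$. Then $$\mathbb E\big[\|\hat\mu^{LS}(K)-\mu\|^2\big]\le \|u-\mu\|^2+\frac{\sigma^2}{n}\,\delta(T_{K,u}),$$ where the expectation on the left is finite. Furthermore, for every $x>0$, with probability at least $1-e^{-x}$, $$\|\hat\mu^{LS}(K)-\mu\|^2-\|u-\mu\|^2\le\frac{\sigma^2}{n}\Big(\delta(T_{K,u})^{1/2}+\sqrt{2x}\Big)^2\le\frac{\sigma^2}{n}\Big(2\,\delta(T_{K,u})+4x\Big).$$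 -/

import Mathlib

open MeasureTheory ProbabilityTheory

noncomputable section

/-- The squared scaled norm `(1/n) ∑ i, (v i) ^ 2` on `ℝⁿ`. -/
def scaledNormSq {n : ℕ} (v : EuclideanSpace ℝ (Fin n)) : ℝ :=
  (1 / (n : ℝ)) * ∑ i, (v i) ^ 2

/-- `p` is a least squares estimate over `K` for the observation `y`:
`p ∈ argmin_{v ∈ K} (1/n) ∑ i, (y i - v i) ^ 2`. -/
def IsLeastSquares {n : ℕ} (K : Set (EuclideanSpace ℝ (Fin n)))
    (y p : EuclideanSpace ℝ (Fin n)) : Prop :=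
  p ∈ K ∧ ∀ v ∈ K, scaledNormSq (y - p) ≤ scaledNormSq (y - v)

/-- `p` is a point of `K` at minimal Euclidean distance from `y`. -/
def IsNearestPoint {n : ℕ} (K : Set (EuclideanSpace ℝ (Fin n)))
    (y p : EuclideanSpace ℝ (Fin n)) : Prop :=
  p ∈ K ∧ ∀ v ∈ K, ‖y - p‖ ≤ ‖y - v‖

/-- The Euclidean projection of `y` onto `K`. For a nonempty closed convex `K` the nearest point
exists and is unique (`isNearestPoint_convexProj`, `IsNearestPoint.eq_convexProj`). -/
def convexProj {n : ℕ} (K : Set (EuclideanSpace ℝ (Fin n)))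
    (y : EuclideanSpace ℝ (Fin n)) : EuclideanSpace ℝ (Fin n) :=
  Classical.epsilon (IsNearestPoint K y)

theorem isNearestPoint_convexProj {n : ℕ} {K : Set (EuclideanSpace ℝ (Fin n))}
    (hne : K.Nonempty) (hcl : IsClosed K) (y : EuclideanSpace ℝ (Fin n)) :
    IsNearestPoint K y (convexProj K y) := by
  apply Classical.epsilon_spec (p := IsNearestPoint K y)
  obtain ⟨p, hp, h⟩ := hcl.exists_infDist_eq_dist hne y
  refine ⟨p, hp, fun v hv => ?_⟩
  rw [← dist_eq_norm, ← dist_eq_norm, ← h]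
  exact Metric.infDist_le_dist_of_mem hv

theorem IsNearestPoint.eq_convexProj {n : ℕ} {K : Set (EuclideanSpace ℝ (Fin n))}
    (hcl : IsClosed K) (hconv : Convex ℝ K) {y p : EuclideanSpace ℝ (Fin n)}
    (hp : IsNearestPoint K y p) : p = convexProj K y := by
  have hq := isNearestPoint_convexProj ⟨p, hp.1⟩ hcl y
  set q := convexProj K y
  have hm : (1 / 2 : ℝ) • p + (1 / 2 : ℝ) • q ∈ K :=
    hconv hp.1 hq.1 (by norm_num) (by norm_num) (by norm_num)
  have h1 := hp.2 _ hq.1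
  have h2 := hq.2 _ hp.1
  have h3 := hp.2 _ hm
  have e : y - ((1 / 2 : ℝ) • p + (1 / 2 : ℝ) • q) = (1 / 2 : ℝ) • ((y - p) + (y - q)) := by
    module
  rw [e, norm_smul, Real.norm_of_nonneg (by norm_num)] at h3
  have h4 := parallelogram_law_with_norm ℝ (y - p) (y - q)
  have e2 : (y - p) - (y - q) = -(p - q) := by abel
  rw [e2, norm_neg] at h4
  have h0 := norm_nonneg (y - p)
  have h5 : ‖p - q‖ * ‖p - q‖ ≤ 0 := by nlinarith [le_antisymm h1 h2]
  exact sub_eq_zero.1 (norm_eq_zero.1 (by nlinarith [norm_nonneg (p - q)]))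

/-- The tangent cone of `K` at `u`: the closure of `{t (v - u) : t ≥ 0, v ∈ K}`. -/
def closedTangentCone {n : ℕ} (K : Set (EuclideanSpace ℝ (Fin n)))
    (u : EuclideanSpace ℝ (Fin n)) : Set (EuclideanSpace ℝ (Fin n)) :=
  closure {w | ∃ t : ℝ, 0 ≤ t ∧ ∃ v ∈ K, w = t • (v - u)}

/-- The statistical dimension `E ‖Π_C(g)‖²`, `g ∼ N(0, Iₙ)`, of a closed convex cone `C`. -/
def statDim {n : ℕ} (C : Set (EuclideanSpace ℝ (Fin n))) : ℝ :=
  ∫ g, ‖convexProj C g‖ ^ 2 ∂(multivariateGaussian (0 : EuclideanSpace ℝ (Fin n)) 1)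

end

/-! ### Brunn-Minkowski and Prékopa-Leindler on the line -/

open scoped ENNReal

/-! Let `p` be the projection of `μ + z` onto `K`. Expanding around `u`, `‖p - μ‖²` is `‖u - μ‖²`
plus `2⟪z, p - u⟫ - ‖p - u‖²` plus a term that the obtuse-angle criterion makes nonpositive. Since
`p - u` lies in the tangent cone `T`, the middle term is at most `‖Π_T z‖²`
(`IsNearestPoint.norm_sub_sq_le`). By homogeneity `‖Π_T ξ‖²` has the law of `σ²‖Π_T g‖²`, and
integration gives the bound in expectation.

For the tail, `g ↦ ‖Π_T g‖` is 1-Lipschitz with mean at most `√δ(T)`, so Gaussian concentration with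
the sharp rate `exp(-r²/2)` applies at `r = √(2x)`. That rate comes from the Gaussian
Prékopa-Leindler inequality applied to `1` and `exp(l f - l²/2)`, in the limit where the weight `t`
of the second function tends to 0 (`cgf_le_of_lipschitz`). -/

theorem Real.volume_add_volume_le_of_isCompact {A B C : Set ℝ} (hA : IsCompact A)
    (hB : IsCompact B) (hA0 : A.Nonempty) (hB0 : B.Nonempty)
    (h : ∀ a ∈ A, ∀ b ∈ B, a + b ∈ C) : volume A + volume B ≤ volume C := by
  obtain ⟨p, hp, hpA⟩ := hA.exists_isGreatest hA0
  obtain ⟨q, hq, hqB⟩ := hB.exists_isLeast hB0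
  -- The translates `A + min B` and `max A + B` lie in `C` and meet at most at `max A + min B`.
  have h1 : volume ((fun a => a + q) '' A) = volume A := by
    rw [Set.image_add_right, measure_preimage_add_right]
  have h2 : volume ((fun b => p + b) '' B) = volume B := by
    rw [Set.image_add_left, measure_preimage_add]
  have hd : AEDisjoint volume ((fun a => a + q) '' A) ((fun b => p + b) '' B) := by
    refine measure_mono_null (t := {p + q}) ?_ (measure_singleton _)
    rintro _ ⟨⟨a, ha, rfl⟩, ⟨b, hb, hab⟩⟩
    have h3 := hpA ha
    have h4 := hqB hb
    simp only [Set.mem_singleton_iff] at hab ⊢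
    linarith
  rw [← h1, ← h2, ← measure_union₀ ?_ hd]
  · apply measure_mono
    rintro _ (⟨a, ha, rfl⟩ | ⟨b, hb, rfl⟩)
    · exact h a ha q hq
    · exact h p hp b hb
  · exact (hB.image (by fun_prop)).measurableSet.nullMeasurableSet

/-- The one-dimensional Brunn-Minkowski inequality. -/
theorem Real.volume_add_volume_le {A B C : Set ℝ} (hA : MeasurableSet A) (hB : MeasurableSet B)
    (hA0 : A.Nonempty) (hB0 : B.Nonempty) (h : ∀ a ∈ A, ∀ b ∈ B, a + b ∈ C) :
    volume A + volume B ≤ volume C := by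
  obtain ⟨a, ha⟩ := hA0
  obtain ⟨b, hb⟩ := hB0
  rw [hA.measure_eq_iSup_isCompact, hB.measure_eq_iSup_isCompact]
  simp only [iSup_and']
  refine ENNReal.biSup_add_biSup_le' ⟨∅, by simp⟩ ⟨∅, by simp⟩ fun K hK L hL => ?_
  -- The inner compact sets may be empty; adjoining a point of each set repairs this.
  refine le_trans (add_le_add (measure_mono (Set.subset_insert a K))
    (measure_mono (Set.subset_insert b L))) ?_
  refine Real.volume_add_volume_le_of_isCompact (hK.2.insert a) (hL.2.insert b) ⟨a, by simp⟩
    ⟨b, by simp⟩ fun x hx y hy => h x ?_ y ?_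
  · exact Set.insert_subset ha hK.1 hx
  · exact Set.insert_subset hb hL.1 hy

theorem Real.weighted_volume_add_le {t : ℝ} (ht0 : 0 < t) (ht1 : t < 1) {A B C : Set ℝ}
    (hA : MeasurableSet A) (hB : MeasurableSet B) (hA0 : A.Nonempty) (hB0 : B.Nonempty)
    (h : ∀ a ∈ A, ∀ b ∈ B, (1 - t) * a + t * b ∈ C) :
    ENNReal.ofReal (1 - t) * volume A + ENNReal.ofReal t * volume B ≤ volume C := by
  have key : ∀ (s : ℝ) (D : Set ℝ), 0 < s →
      volume ((fun x => s⁻¹ * x) ⁻¹' D) = ENNReal.ofReal s * volume D := by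
    intro s D hs
    rw [Real.volume_preimage_mul_left (inv_ne_zero hs.ne'), inv_inv, abs_of_pos hs]
  have hs : 0 < 1 - t := by linarith
  rw [← key _ _ ht0, ← key _ _ hs]
  refine Real.volume_add_volume_le (hA.preimage (by fun_prop)) (hB.preimage (by fun_prop))
    ?_ ?_ ?_
  · obtain ⟨a, ha⟩ := hA0
    exact ⟨(1 - t) * a, by simpa [hs.ne'] using ha⟩
  · obtain ⟨a, ha⟩ := hB0
    exact ⟨t * a, by simpa [ht0.ne'] using ha⟩
  · intro a ha b hb
    have := h _ ha _ hb
    rwa [mul_inv_cancel_left₀ hs.ne', mul_inv_cancel_left₀ ht0.ne'] at this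

theorem ENNReal.geom_mean_le_arith_mean2_weighted {t : ℝ} (ht0 : 0 < t) (ht1 : t < 1)
    (a b : ℝ≥0∞) :
    a ^ (1 - t) * b ^ t ≤ ENNReal.ofReal (1 - t) * a + ENNReal.ofReal t * b := by
  have hs : 0 < 1 - t := by linarith
  rcases eq_or_ne a ∞ with rfl | ha
  · rw [ENNReal.mul_top (by simpa using ht1)]; simp
  rcases eq_or_ne b ∞ with rfl | hb
  · rw [ENNReal.mul_top (by simpa using ht0)]; simp
  lift a to NNReal using ha
  lift b to NNReal using hb
  rw [← ENNReal.coe_rpow_of_nonneg _ hs.le, ← ENNReal.coe_rpow_of_nonneg _ ht0.le]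
  simp only [ENNReal.ofReal]
  have h := NNReal.geom_mean_le_arith_mean2_weighted (1 - t).toNNReal t.toNNReal a b
    (by rw [← Real.toNNReal_add hs.le ht0.le]; simp)
  rw [Real.coe_toNNReal _ hs.le, Real.coe_toNNReal _ ht0.le] at h
  exact_mod_cast h

/-- Equal suprema make the superlevel sets of `f` and `g` nonempty at exactly the same levels, those
below 1. There Brunn-Minkowski compares them with those of `min h 1`; integrating over levels gives
the arithmetic-mean bound, stronger than the geometric one. -/
theorem prekopaLeindler_of_sup_eq_one {t : ℝ} (ht0 : 0 < t) (ht1 : t < 1) {f g h : ℝ → ℝ≥0∞}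
    (hf : Measurable f) (hg : Measurable g) (hh : Measurable h)
    (hf1 : ⨆ x, f x = 1) (hg1 : ⨆ x, g x = 1)
    (H : ∀ x y, f x ^ (1 - t) * g y ^ t ≤ h ((1 - t) * x + t * y)) :
    (∫⁻ x, f x) ^ (1 - t) * (∫⁻ x, g x) ^ t ≤ ∫⁻ x, h x := by
  have hs : 0 < 1 - t := by linarith
  refine (ENNReal.geom_mean_le_arith_mean2_weighted ht0 ht1 _ _).trans ?_
  have cake : ∀ k : ℝ → ℝ≥0∞, Measurable k → (∀ x, k x ≤ 1) →
      ∫⁻ x, k x = ∫⁻ a in Set.Ioi 0, volume {x | ENNReal.ofReal a < k x} := by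
    intro k hk hk1
    have hfin : ∀ x, k x ≠ ∞ := fun x => ne_top_of_le_ne_top ENNReal.one_ne_top (hk1 x)
    have := lintegral_eq_lintegral_meas_lt volume (f := fun x => (k x).toReal)
      (Filter.Eventually.of_forall fun x => ENNReal.toReal_nonneg) hk.ennreal_toReal.aemeasurable
    simp only [ENNReal.ofReal_toReal (hfin _)] at this
    rw [this]
    refine setLIntegral_congr_fun measurableSet_Ioi fun a ha => ?_
    simp only [ENNReal.ofReal_lt_iff_lt_toReal (le_of_lt ha) (hfin _)]
  have hfle : ∀ x, f x ≤ 1 := fun x => hf1 ▸ le_iSup f x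
  have hgle : ∀ x, g x ≤ 1 := fun x => hg1 ▸ le_iSup g x
  have hmin : ∫⁻ x, min (h x) 1 ≤ ∫⁻ x, h x := lintegral_mono fun x => min_le_left _ _
  refine le_trans ?_ hmin
  have meas : ∀ k : ℝ → ℝ≥0∞,
      Measurable fun a : ℝ => volume {x | ENNReal.ofReal a < k x} := by
    intro k
    refine Antitone.measurable fun a b hab => measure_mono fun x hx => ?_
    exact (ENNReal.ofReal_le_ofReal hab).trans_lt hx
  rw [cake f hf hfle, cake g hg hgle, cake _ (hh.min measurable_const) fun x => min_le_right _ _,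
    ← lintegral_const_mul _ (meas f), ← lintegral_const_mul _ (meas g),
    ← lintegral_add_left ((meas f).const_mul _)]
  refine setLIntegral_mono (meas _) fun a ha => ?_
  rcases le_or_gt 1 (ENNReal.ofReal a) with h1 | h1
  · have e1 : {x | ENNReal.ofReal a < f x} = ∅ :=
      Set.eq_empty_of_forall_notMem fun x hx => (lt_of_lt_of_le hx ((hfle x).trans h1)).false
    have e2 : {x | ENNReal.ofReal a < g x} = ∅ :=
      Set.eq_empty_of_forall_notMem fun x hx => (lt_of_lt_of_le hx ((hgle x).trans h1)).false
    simp [e1, e2]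
  · refine Real.weighted_volume_add_le ht0 ht1 (measurableSet_lt measurable_const hf)
      (measurableSet_lt measurable_const hg) ?_ ?_ fun x hx y hy => ?_
    · exact lt_iSup_iff.1 (hf1 ▸ h1)
    · exact lt_iSup_iff.1 (hg1 ▸ h1)
    · refine lt_min (lt_of_lt_of_le ?_ (H x y)) h1
      have : ENNReal.ofReal a = ENNReal.ofReal a ^ (1 - t) * ENNReal.ofReal a ^ t := by
        rw [← ENNReal.rpow_add_of_nonneg _ _ hs.le ht0.le]; simp
      rw [this]
      exact ENNReal.mul_lt_mul (ENNReal.rpow_lt_rpow hx hs) (ENNReal.rpow_lt_rpow hy ht0)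

theorem prekopaLeindler_of_sup_ne_top {t : ℝ} (ht0 : 0 < t) (ht1 : t < 1) {f g h : ℝ → ℝ≥0∞}
    (hf : Measurable f) (hg : Measurable g) (hh : Measurable h)
    (hf1 : ⨆ x, f x ≠ ∞) (hg1 : ⨆ x, g x ≠ ∞)
    (H : ∀ x y, f x ^ (1 - t) * g y ^ t ≤ h ((1 - t) * x + t * y)) :
    (∫⁻ x, f x) ^ (1 - t) * (∫⁻ x, g x) ^ t ≤ ∫⁻ x, h x := by
  have hs : 0 < 1 - t := by linarith
  set F := ⨆ x, f x with hF
  set G := ⨆ x, g x with hG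
  rcases eq_or_ne F 0 with hF0 | hF0
  · have : ∀ x, f x = 0 := fun x => le_antisymm (hF0 ▸ le_iSup f x) zero_le
    simp [this, ENNReal.zero_rpow_of_pos hs]
  rcases eq_or_ne G 0 with hG0 | hG0
  · have : ∀ x, g x = 0 := fun x => le_antisymm (hG0 ▸ le_iSup g x) zero_le
    simp [this, ENNReal.zero_rpow_of_pos ht0]
  have key := prekopaLeindler_of_sup_eq_one ht0 ht1 (f := fun x => F⁻¹ * f x)
    (g := fun x => G⁻¹ * g x) (h := fun x => (F⁻¹ ^ (1 - t) * G⁻¹ ^ t) * h x)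
    (hf.const_mul _) (hg.const_mul _) (hh.const_mul _)
    (by rw [← ENNReal.mul_iSup, ENNReal.inv_mul_cancel hF0 hf1])
    (by rw [← ENNReal.mul_iSup, ENNReal.inv_mul_cancel hG0 hg1])
    (fun x y => by
      rw [ENNReal.mul_rpow_of_nonneg _ _ hs.le, ENNReal.mul_rpow_of_nonneg _ _ ht0.le,
        mul_mul_mul_comm]
      gcongr
      exact H x y)
  rw [lintegral_const_mul _ hf, lintegral_const_mul _ hg, lintegral_const_mul _ hh,
    ENNReal.mul_rpow_of_nonneg _ _ hs.le, ENNReal.mul_rpow_of_nonneg _ _ ht0.le,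
    mul_mul_mul_comm] at key
  have hne : F⁻¹ ^ (1 - t) * G⁻¹ ^ t ≠ 0 := mul_ne_zero
    (fun h0 => ENNReal.inv_ne_zero.2 hf1 ((ENNReal.rpow_eq_zero_iff_of_pos hs).1 h0))
    (fun h0 => ENNReal.inv_ne_zero.2 hg1 ((ENNReal.rpow_eq_zero_iff_of_pos ht0).1 h0))
  have hne' : F⁻¹ ^ (1 - t) * G⁻¹ ^ t ≠ ∞ := ENNReal.mul_ne_top
    (ENNReal.rpow_ne_top_of_nonneg hs.le (ENNReal.inv_ne_top.2 hF0))
    (ENNReal.rpow_ne_top_of_nonneg ht0.le (ENNReal.inv_ne_top.2 hG0))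
  exact (ENNReal.mul_le_mul_iff_right hne hne').1 key

/-- The Prékopa-Leindler inequality on the real line. -/
theorem prekopaLeindler {t : ℝ} (ht0 : 0 < t) (ht1 : t < 1) {f g h : ℝ → ℝ≥0∞}
    (hf : Measurable f) (hg : Measurable g) (hh : Measurable h)
    (H : ∀ x y, f x ^ (1 - t) * g y ^ t ≤ h ((1 - t) * x + t * y)) :
    (∫⁻ x, f x) ^ (1 - t) * (∫⁻ x, g x) ^ t ≤ ∫⁻ x, h x := by
  have hs : 0 < 1 - t := by linarith
  -- Truncating `f` and `g` preserves the hypothesis and makes the suprema finite; monotone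
  -- convergence removes the truncation.
  have trunc : ∀ k : ℝ → ℝ≥0∞, Measurable k →
      ∫⁻ x, k x = ⨆ m : ℕ, ∫⁻ x, min (k x) m := by
    intro k hk
    rw [← lintegral_iSup (fun m => hk.min measurable_const)
      (fun a b hab x => min_le_min le_rfl (by exact_mod_cast hab))]
    refine lintegral_congr fun x => ?_
    change _ = ⨆ m : ℕ, k x ⊓ (m : ℝ≥0∞)
    rw [← inf_iSup_eq, ENNReal.iSup_natCast, inf_top_eq]
  have hpow : ∀ {s : ℝ} (hs : 0 < s) (a : ℕ → ℝ≥0∞), (⨆ m, a m) ^ s = ⨆ m, a m ^ s :=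
    fun hs a => (ENNReal.orderIsoRpow _ hs).map_iSup a
  rw [trunc f hf, trunc g hg, hpow hs, hpow ht0, ENNReal.iSup_mul]
  refine iSup_le fun m => ?_
  rw [ENNReal.mul_iSup]
  refine iSup_le fun k => ?_
  refine prekopaLeindler_of_sup_ne_top ht0 ht1 (hf.min measurable_const)
    (hg.min measurable_const) hh ?_ ?_ fun x y => le_trans ?_ (H x y)
  · exact ne_top_of_le_ne_top (ENNReal.natCast_ne_top m) (iSup_le fun x => min_le_right _ _)
  · exact ne_top_of_le_ne_top (ENNReal.natCast_ne_top k) (iSup_le fun x => min_le_right _ _)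
  · gcongr <;> exact min_le_left _ _

/-! ### Gaussian Prékopa-Leindler -/

/-- The quantitative log-concavity of the Gaussian density: the exponential gain is what allows a
weaker hypothesis on `f`, `g`, `h` relative to the Gaussian measure. -/
theorem gaussianPDF_rpow_mul_rpow {t : ℝ} (ht0 : 0 < t) (ht1 : t < 1) (x y : ℝ) :
    gaussianPDF 0 1 x ^ (1 - t) * gaussianPDF 0 1 y ^ t *
      ENNReal.ofReal (Real.exp (t * (1 - t) / 2 * (x - y) ^ 2)) =
    gaussianPDF 0 1 ((1 - t) * x + t * y) := by
  have hs : 0 < 1 - t := by linarith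
  have hc : 0 < (√(2 * Real.pi * 1))⁻¹ := by positivity
  simp only [gaussianPDF, gaussianPDFReal, NNReal.coe_one]
  rw [ENNReal.ofReal_rpow_of_nonneg (by positivity) hs.le,
    ENNReal.ofReal_rpow_of_nonneg (by positivity) ht0.le, ← ENNReal.ofReal_mul (by positivity),
    ← ENNReal.ofReal_mul (by positivity), Real.mul_rpow hc.le (Real.exp_pos _).le,
    Real.mul_rpow hc.le (Real.exp_pos _).le, mul_mul_mul_comm, ← Real.rpow_add hc,
    sub_add_cancel, Real.rpow_one, ← Real.exp_mul, ← Real.exp_mul, mul_assoc, ← Real.exp_add,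
    ← Real.exp_add]
  congr 3
  ring

/-- The Prékopa-Leindler inequality relative to the standard Gaussian measure on `ℝ`. -/
theorem prekopaLeindler_gaussianReal {t : ℝ} (ht0 : 0 < t) (ht1 : t < 1) {f g h : ℝ → ℝ≥0∞}
    (hf : Measurable f) (hg : Measurable g) (hh : Measurable h)
    (H : ∀ x y, f x ^ (1 - t) * g y ^ t ≤
      ENNReal.ofReal (Real.exp (t * (1 - t) / 2 * (x - y) ^ 2)) * h ((1 - t) * x + t * y)) :
    (∫⁻ x, f x ∂gaussianReal 0 1) ^ (1 - t) * (∫⁻ x, g x ∂gaussianReal 0 1) ^ t ≤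
      ∫⁻ x, h x ∂gaussianReal 0 1 := by
  have hs : 0 < 1 - t := by linarith
  have hφ := measurable_gaussianPDF 0 1
  rw [gaussianReal_of_var_ne_zero 0 one_ne_zero, lintegral_withDensity_eq_lintegral_mul _ hφ hf,
    lintegral_withDensity_eq_lintegral_mul _ hφ hg, lintegral_withDensity_eq_lintegral_mul _ hφ hh]
  refine prekopaLeindler ht0 ht1 (hφ.mul hf) (hφ.mul hg) (hφ.mul hh) fun x y => ?_
  simp only [Pi.mul_apply]
  rw [ENNReal.mul_rpow_of_nonneg _ _ hs.le, ENNReal.mul_rpow_of_nonneg _ _ ht0.le,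
    mul_mul_mul_comm, ← gaussianPDF_rpow_mul_rpow ht0 ht1 x y, mul_assoc _ (ENNReal.ofReal _)]
  exact mul_le_mul_right (H x y) _

/-- The Prékopa-Leindler inequality relative to the standard Gaussian measure on `ℝⁿ`. -/
theorem prekopaLeindler_pi_gaussianReal {t : ℝ} (ht0 : 0 < t) (ht1 : t < 1) {n : ℕ}
    {f g h : (Fin n → ℝ) → ℝ≥0∞} (hf : Measurable f) (hg : Measurable g) (hh : Measurable h)
    (H : ∀ x y, f x ^ (1 - t) * g y ^ t ≤
      ENNReal.ofReal (Real.exp (t * (1 - t) / 2 * ∑ i, (x i - y i) ^ 2)) *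
        h ((1 - t) • x + t • y)) :
    (∫⁻ x, f x ∂Measure.pi fun _ => gaussianReal 0 1) ^ (1 - t) *
        (∫⁻ x, g x ∂Measure.pi fun _ => gaussianReal 0 1) ^ t ≤
      ∫⁻ x, h x ∂Measure.pi fun _ => gaussianReal 0 1 := by
  induction n with
  | zero =>
    have key : ∀ k : (Fin 0 → ℝ) → ℝ≥0∞,
        ∫⁻ x, k x ∂Measure.pi (fun _ => gaussianReal 0 1) = k 0 := by
      intro k
      rw [Measure.pi_of_empty _ 0, lintegral_dirac]
    rw [key, key, key]
    refine (H 0 0).trans (le_of_eq ?_)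
    simp
  | succ n ih =>
    have fubini : ∀ k : (Fin (n + 1) → ℝ) → ℝ≥0∞, Measurable k →
        ∫⁻ x, k x ∂Measure.pi (fun _ : Fin (n + 1) => gaussianReal 0 1) =
          ∫⁻ a, ∫⁻ x, k (Fin.cons a x) ∂Measure.pi (fun _ : Fin n => gaussianReal 0 1)
            ∂gaussianReal 0 1 := by
      intro k hk
      have e := (measurePreserving_piFinSuccAbove
        (fun _ : Fin (n + 1) => gaussianReal 0 1) 0).symm
      rw [← e.lintegral_comp hk, lintegral_prod (fun p => k _) (hk.comp e.measurable).aemeasurable]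
      exact lintegral_congr fun a => lintegral_congr fun x =>
        congrArg k (Fin.insertNth_zero' a x)
    have mcons : Measurable fun p : ℝ × (Fin n → ℝ) => (Fin.cons p.1 p.2 : Fin (n + 1) → ℝ) := by
      refine measurable_pi_iff.2 fun i => ?_
      refine Fin.cases ?_ (fun j => ?_) i
      · simpa using measurable_fst
      · simpa [Function.comp_def] using (measurable_pi_apply j).comp measurable_snd
    have mfib : ∀ k : (Fin (n + 1) → ℝ) → ℝ≥0∞, Measurable k → ∀ a : ℝ,
        Measurable fun x : Fin n → ℝ => k (Fin.cons a x) :=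
      fun k hk a => (hk.comp mcons).comp measurable_prodMk_left
    have mint : ∀ k : (Fin (n + 1) → ℝ) → ℝ≥0∞, Measurable k → Measurable fun a : ℝ =>
        ∫⁻ x, k (Fin.cons a x) ∂Measure.pi (fun _ : Fin n => gaussianReal 0 1) :=
      fun k hk => (hk.comp mcons).lintegral_prod_right'
    rw [fubini f hf, fubini g hg, fubini h hh]
    -- The one-dimensional inequality acts on the fibre integrals. Its hypothesis is the induction
    -- hypothesis on fibres, with the first coordinate's factor absorbed into `h`.
    refine prekopaLeindler_gaussianReal ht0 ht1 (mint f hf) (mint g hg) (mint h hh) fun a b => ?_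
    rw [← lintegral_const_mul _ (mfib h hh _)]
    refine ih (mfib f hf a) (mfib g hg b) ((mfib h hh _).const_mul _) fun x y => ?_
    refine (H (Fin.cons a x) (Fin.cons b y)).trans (le_of_eq ?_)
    have e : (1 - t) • (Fin.cons a x : Fin (n + 1) → ℝ) + t • (Fin.cons b y : Fin (n + 1) → ℝ) =
        Fin.cons ((1 - t) * a + t * b) ((1 - t) • x + t • y) := by
      ext i
      refine Fin.cases ?_ (fun j => ?_) i <;> simp
    rw [e, ← mul_assoc, ← ENNReal.ofReal_mul (Real.exp_pos _).le, ← Real.exp_add]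
    simp only [Fin.sum_univ_succ, Fin.cons_zero, Fin.cons_succ]
    congr 3
    ring

open scoped Topology

/-- The Prékopa-Leindler inequality relative to the standard Gaussian measure on Euclidean
space. -/
theorem prekopaLeindler_stdGaussian {t : ℝ} (ht0 : 0 < t) (ht1 : t < 1) {n : ℕ}
    {f g h : EuclideanSpace ℝ (Fin n) → ℝ≥0∞} (hf : Measurable f) (hg : Measurable g)
    (hh : Measurable h)
    (H : ∀ x y, f x ^ (1 - t) * g y ^ t ≤
      ENNReal.ofReal (Real.exp (t * (1 - t) / 2 * ‖x - y‖ ^ 2)) * h ((1 - t) • x + t • y)) :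
    (∫⁻ x, f x ∂stdGaussian _) ^ (1 - t) * (∫⁻ x, g x ∂stdGaussian _) ^ t ≤
      ∫⁻ x, h x ∂stdGaussian _ := by
  have m : Measurable (WithLp.toLp 2 : (Fin n → ℝ) → EuclideanSpace ℝ (Fin n)) := by fun_prop
  rw [← map_pi_eq_stdGaussian, lintegral_map hf m, lintegral_map hg m, lintegral_map hh m]
  refine prekopaLeindler_pi_gaussianReal ht0 ht1 (hf.comp m) (hg.comp m) (hh.comp m)
    fun x y => ?_
  refine (H _ _).trans (le_of_eq ?_)
  rw [EuclideanSpace.real_norm_sq_eq]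
  rfl

/-! ### Gaussian concentration for Lipschitz functions -/

section Concentration

variable {n : ℕ} {f : EuclideanSpace ℝ (Fin n) → ℝ} {a b : ℝ}

theorem mgf_rpow_le_of_lipschitz (hf : LipschitzWith 1 f) (hb : ∀ x, f x ∈ Set.Icc a b)
    {l t : ℝ} (hl : 0 ≤ l) (ht0 : 0 < t) (ht1 : t < 1) :
    (Real.exp (-(l ^ 2 / 2)) * mgf f (stdGaussian _) l) ^ t ≤ mgf f (stdGaussian _) (t * l) := by
  have hm : Measurable f := hf.continuous.measurable
  have hint : ∀ s : ℝ, Integrable (fun x => Real.exp (s * f x)) (stdGaussian _) := fun s =>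
    integrable_exp_mul_of_mem_Icc hm.aemeasurable (Filter.Eventually.of_forall hb)
  have key := prekopaLeindler_stdGaussian ht0 ht1 (f := fun _ => 1)
    (g := fun y => ENNReal.ofReal (Real.exp (-(l ^ 2 / 2)) * Real.exp (l * f y)))
    (h := fun z => ENNReal.ofReal (Real.exp (t * l * f z)))
    measurable_const (by fun_prop) (by fun_prop) ?_
  · rw [lintegral_const, measure_univ, mul_one, ENNReal.one_rpow, one_mul,
      ← ofReal_integral_eq_lintegral_ofReal ((hint l).const_mul _)
        (Filter.Eventually.of_forall fun x => by positivity),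
      ← ofReal_integral_eq_lintegral_ofReal (hint _)
        (Filter.Eventually.of_forall fun x => by positivity), integral_const_mul] at key
    change ENNReal.ofReal (_ * mgf f (stdGaussian _) l) ^ t ≤
      ENNReal.ofReal (mgf f (stdGaussian _) (t * l)) at key
    rw [ENNReal.ofReal_rpow_of_nonneg (mul_nonneg (Real.exp_pos _).le mgf_nonneg) ht0.le] at key
    exact (ENNReal.ofReal_le_ofReal_iff mgf_nonneg).1 key
  · intro x y
    rw [ENNReal.one_rpow, one_mul, ENNReal.ofReal_rpow_of_nonneg (by positivity) ht0.le,
      ← ENNReal.ofReal_mul (by positivity), ← Real.exp_add, ← Real.exp_add, ← Real.exp_mul]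
    refine ENNReal.ofReal_le_ofReal (Real.exp_le_exp.2 ?_)
    have h1 := hf.dist_le_mul y ((1 - t) • x + t • y)
    have e : y - ((1 - t) • x + t • y) = (1 - t) • (y - x) := by module
    rw [Real.dist_eq, dist_eq_norm, e, norm_smul, Real.norm_of_nonneg (by linarith), norm_sub_rev,
      NNReal.coe_one, one_mul] at h1
    have h2 := (le_abs_self _).trans h1
    have h3 := mul_le_mul_of_nonneg_left h2 (mul_nonneg ht0.le hl)
    -- With `D = ‖x - y‖`, the Lipschitz bound costs `t(1-t)lD ≤ t(1-t)(l² + D²)/2`; the `D²` part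
    -- is the Gaussian gain, the `l²` part is at most `tl²/2`.
    nlinarith [mul_nonneg (mul_nonneg ht0.le (sub_nonneg.2 ht1.le)) (sq_nonneg (l - ‖x - y‖)),
      mul_nonneg (mul_nonneg ht0.le ht0.le) (sq_nonneg l)]

/-- Taking logarithms in `mgf_rpow_le_of_lipschitz` and dividing by `t` bounds `cgf l - l²/2` by a
difference quotient at 0, whose limit is `l` times the mean. -/
theorem cgf_le_of_lipschitz (hf : LipschitzWith 1 f) (hb : ∀ x, f x ∈ Set.Icc a b)
    {l : ℝ} (hl : 0 ≤ l) :
    cgf f (stdGaussian _) l ≤ l * ∫ x, f x ∂stdGaussian _ + l ^ 2 / 2 := by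
  set γ := stdGaussian (EuclideanSpace ℝ (Fin n))
  have hm : Measurable f := hf.continuous.measurable
  have hint : ∀ s : ℝ, Integrable (fun x => Real.exp (s * f x)) γ := fun s =>
    integrable_exp_mul_of_mem_Icc hm.aemeasurable (Filter.Eventually.of_forall hb)
  have huniv : integrableExpSet f γ = Set.univ := Set.eq_univ_of_forall hint
  have h0 : (0 : ℝ) ∈ interior (integrableExpSet f γ) := by simp [huniv]
  have hd : HasDerivAt (cgf f γ) (∫ x, f x ∂γ) (0 * l) := by
    have h1 : DifferentiableAt ℝ (cgf f γ) 0 := (analyticAt_cgf h0).differentiableAt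
    have h2 := h1.hasDerivAt
    rw [deriv_cgf_zero h0] at h2
    simpa using h2
  have hd2 : HasDerivAt (fun t : ℝ => cgf f γ (t * l)) ((∫ x, f x ∂γ) * l) 0 := by
    simpa [Function.comp_def] using hd.comp 0 ((hasDerivAt_id (0 : ℝ)).mul_const l)
  have hlim := hd2.tendsto_slope_zero_right
  have hev : ∀ᶠ t : ℝ in 𝓝[>] 0, cgf f γ l - l ^ 2 / 2 ≤
      t⁻¹ • (cgf f γ ((0 + t) * l) - cgf f γ (0 * l)) := by
    filter_upwards [Ioo_mem_nhdsGT (zero_lt_one' ℝ)] with t ht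
    have hpos : ∀ s, 0 < mgf f γ s := fun s => mgf_pos (hint s)
    have h1 := Real.log_le_log (Real.rpow_pos_of_pos (mul_pos (Real.exp_pos _) (hpos l)) t)
      (mgf_rpow_le_of_lipschitz hf hb hl ht.1 ht.2)
    rw [Real.log_rpow (mul_pos (Real.exp_pos _) (hpos l)),
      Real.log_mul (Real.exp_pos _).ne' (hpos l).ne', Real.log_exp] at h1
    rw [zero_mul, cgf_zero, zero_add, sub_zero, smul_eq_mul, inv_mul_eq_div, le_div_iff₀ ht.1]
    simp only [cgf]
    linarith
  have := ge_of_tendsto hlim hev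
  linarith

/-- Gaussian concentration for nonnegative `1`-Lipschitz functions, around an upper bound of the
expectation. -/
theorem stdGaussian_real_ge_le_of_lipschitz (hf : LipschitzWith 1 f) (hf0 : ∀ x, 0 ≤ f x)
    (hfi : Integrable f (stdGaussian _)) {m r : ℝ} (hm : ∫ x, f x ∂stdGaussian _ ≤ m)
    (hr : 0 ≤ r) :
    (stdGaussian _).real {x | m + r ≤ f x} ≤ Real.exp (-(r ^ 2 / 2)) := by
  set γ := stdGaussian (EuclideanSpace ℝ (Fin n))
  -- Capping at `m + r` makes the function bounded, keeps the event and does not raise the mean.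
  set k : EuclideanSpace ℝ (Fin n) → ℝ := fun x => min (f x) (m + r) with hk
  have hm0 : 0 ≤ m := (integral_nonneg hf0).trans hm
  have hkl : LipschitzWith 1 k := hf.min_const _
  have hkb : ∀ x, k x ∈ Set.Icc 0 (m + r) := fun x =>
    ⟨le_min (hf0 x) (by positivity), min_le_right _ _⟩
  have hki : Integrable k γ := Integrable.of_mem_Icc 0 (m + r)
    hkl.continuous.measurable.aemeasurable (Filter.Eventually.of_forall hkb)
  have hkm : ∫ x, k x ∂γ ≤ m :=
    (integral_mono hki hfi fun x => min_le_left _ _).trans hm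
  have hset : {x | m + r ≤ f x} = {x | m + r ≤ k x} := by
    ext x
    simp [hk]
  have hint := integrable_exp_mul_of_mem_Icc (t := r) hkl.continuous.measurable.aemeasurable
    (ae_of_all γ hkb)
  rw [hset]
  -- Chernoff's bound at the optimal parameter `r`.
  refine (measure_ge_le_exp_cgf (m + r) hr hint).trans (Real.exp_le_exp.2 ?_)
  have := cgf_le_of_lipschitz hkl hkb hr
  nlinarith [mul_le_mul_of_nonneg_left hkm hr]

end Concentration

/-! ### Projections onto convex sets and cones -/

open scoped RealInnerProductSpace

section Projection

variable {n : ℕ} {K : Set (EuclideanSpace ℝ (Fin n))}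

theorem IsNearestPoint.inner_sub_sub_nonpos (hconv : Convex ℝ K) {y p v : EuclideanSpace ℝ (Fin n)}
    (hp : IsNearestPoint K y p) (hv : v ∈ K) : ⟪y - p, v - p⟫ ≤ 0 := by
  refine (norm_eq_iInf_iff_real_inner_le_zero hconv hp.1).1 (le_antisymm ?_ ?_) v hv
  · have : Nonempty K := ⟨⟨p, hp.1⟩⟩
    exact le_ciInf fun w => hp.2 w w.2
  · exact ciInf_le (f := fun w : K => ‖y - w‖) ⟨0, by rintro _ ⟨w, rfl⟩; exact norm_nonneg _⟩
      ⟨p, hp.1⟩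

theorem lipschitzWith_convexProj (hne : K.Nonempty) (hcl : IsClosed K) (hconv : Convex ℝ K) :
    LipschitzWith 1 (convexProj K) := by
  refine LipschitzWith.of_dist_le_mul fun x y => ?_
  have hx := isNearestPoint_convexProj hne hcl x
  have hy := isNearestPoint_convexProj hne hcl y
  have h1 := hx.inner_sub_sub_nonpos hconv hy.1
  have h2 := hy.inner_sub_sub_nonpos hconv hx.1
  rw [dist_eq_norm, dist_eq_norm, NNReal.coe_one, one_mul]
  set p := convexProj K x
  set q := convexProj K y
  have h3 : ‖p - q‖ ^ 2 = ⟪x - y, p - q⟫ + ⟪x - p, q - p⟫ + ⟪y - q, p - q⟫ := by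
    rw [← real_inner_self_eq_norm_sq]
    simp only [inner_sub_left, inner_sub_right]
    ring
  have h4 := real_inner_le_norm (x - y) (p - q)
  by_contra! h
  nlinarith [norm_nonneg (x - y)]

theorem scaledNormSq_eq (v : EuclideanSpace ℝ (Fin n)) : scaledNormSq v = 1 / n * ‖v‖ ^ 2 := by
  rw [EuclideanSpace.real_norm_sq_eq]
  rfl

theorem IsLeastSquares.isNearestPoint (hn : 1 ≤ n) {y p : EuclideanSpace ℝ (Fin n)}
    (h : IsLeastSquares K y p) : IsNearestPoint K y p := by
  refine ⟨h.1, fun v hv => ?_⟩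
  have h1 := h.2 v hv
  have hn' : (0 : ℝ) < 1 / n := one_div_pos.2 (Nat.cast_pos.2 hn)
  rw [scaledNormSq_eq, scaledNormSq_eq, mul_le_mul_iff_right₀ hn'] at h1
  exact (sq_le_sq₀ (norm_nonneg _) (norm_nonneg _)).1 h1

end Projection

section Cone

variable {n : ℕ} {C : Set (EuclideanSpace ℝ (Fin n))}

/-- The rays of the cone allow testing the obtuse-angle criterion at both `2p` and `0`, so the
residual `y - p` is orthogonal to `p`. -/
theorem inner_convexProj_self (hne : C.Nonempty) (hcl : IsClosed C) (hconv : Convex ℝ C)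
    (hcone : ∀ s : ℝ, 0 ≤ s → ∀ w ∈ C, s • w ∈ C) (y : EuclideanSpace ℝ (Fin n)) :
    ⟪y, convexProj C y⟫ = ‖convexProj C y‖ ^ 2 := by
  have hp := isNearestPoint_convexProj hne hcl y
  have h1 := hp.inner_sub_sub_nonpos hconv (hcone 2 (by norm_num) _ hp.1)
  have h2 := hp.inner_sub_sub_nonpos hconv (hcone 0 le_rfl _ hp.1)
  rw [← real_inner_self_eq_norm_sq]
  simp only [inner_sub_left, inner_sub_right, inner_smul_right] at h1 h2
  linarith

theorem two_mul_inner_sub_norm_sq_le (hcl : IsClosed C) (hconv : Convex ℝ C)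
    (hcone : ∀ s : ℝ, 0 ≤ s → ∀ w ∈ C, s • w ∈ C) (y : EuclideanSpace ℝ (Fin n))
    {w : EuclideanSpace ℝ (Fin n)} (hw : w ∈ C) :
    2 * ⟪y, w⟫ - ‖w‖ ^ 2 ≤ ‖convexProj C y‖ ^ 2 := by
  have h1 := (isNearestPoint_convexProj ⟨w, hw⟩ hcl y).2 w hw
  have h2 := pow_le_pow_left₀ (norm_nonneg _) h1 2
  rw [norm_sub_sq_real, norm_sub_sq_real, inner_convexProj_self ⟨w, hw⟩ hcl hconv hcone] at h2
  linarith

theorem convexProj_smul (hne : C.Nonempty) (hcl : IsClosed C) (hconv : Convex ℝ C)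
    (hcone : ∀ s : ℝ, 0 ≤ s → ∀ w ∈ C, s • w ∈ C) {s : ℝ} (hs : 0 < s)
    (y : EuclideanSpace ℝ (Fin n)) : convexProj C (s • y) = s • convexProj C y := by
  have hp := isNearestPoint_convexProj hne hcl y
  refine (IsNearestPoint.eq_convexProj hcl hconv ⟨hcone s hs.le _ hp.1, fun v hv => ?_⟩).symm
  have h := hp.2 _ (hcone s⁻¹ (inv_nonneg.2 hs.le) v hv)
  have e : s • y - v = s • (y - s⁻¹ • v) := by
    rw [smul_sub, smul_inv_smul₀ hs.ne']
  rw [e, ← smul_sub, norm_smul, norm_smul]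
  gcongr

theorem norm_convexProj_le (hne : C.Nonempty) (hcl : IsClosed C) (hconv : Convex ℝ C)
    (hcone : ∀ s : ℝ, 0 ≤ s → ∀ w ∈ C, s • w ∈ C) (y : EuclideanSpace ℝ (Fin n)) :
    ‖convexProj C y‖ ≤ ‖y‖ := by
  have h1 := inner_convexProj_self hne hcl hconv hcone y
  have h2 := real_inner_le_norm y (convexProj C y)
  by_contra! h
  nlinarith [norm_nonneg y]

end Cone

/-! ### The tangent cone and the oracle inequality -/

section TangentCone

variable {n : ℕ} {K : Set (EuclideanSpace ℝ (Fin n))} {u : EuclideanSpace ℝ (Fin n)}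

theorem sub_mem_closedTangentCone {v : EuclideanSpace ℝ (Fin n)} (hv : v ∈ K) :
    v - u ∈ closedTangentCone K u :=
  subset_closure ⟨1, zero_le_one, v, hv, (one_smul _ _).symm⟩

theorem smul_mem_closedTangentCone (s : ℝ) (hs : 0 ≤ s) (w : EuclideanSpace ℝ (Fin n))
    (hw : w ∈ closedTangentCone K u) : s • w ∈ closedTangentCone K u := by
  refine map_mem_closure (continuous_const_smul s) hw ?_
  rintro _ ⟨t, ht, v, hv, rfl⟩
  exact ⟨s * t, mul_nonneg hs ht, v, hv, smul_smul s t _⟩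

theorem convex_closedTangentCone (hK : Convex ℝ K) : Convex ℝ (closedTangentCone K u) := by
  apply Convex.closure
  rintro _ ⟨t₁, ht₁, v₁, hv₁, rfl⟩ _ ⟨t₂, ht₂, v₂, hv₂, rfl⟩ a b ha hb -
  have h1 := mul_nonneg ha ht₁
  have h2 := mul_nonneg hb ht₂
  -- The combination is `(a t₁ + b t₂)(v - u)` with `v` the normalized barycentre; a zero total
  -- weight is treated apart.
  rcases (add_nonneg h1 h2).eq_or_lt with h0 | h0
  · refine ⟨0, le_rfl, v₁, hv₁, ?_⟩
    rw [smul_smul, smul_smul, (by linarith : a * t₁ = 0), (by linarith : b * t₂ = 0)]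
    simp
  · refine ⟨a * t₁ + b * t₂, h0.le, (a * t₁ / (a * t₁ + b * t₂)) • v₁ +
      (b * t₂ / (a * t₁ + b * t₂)) • v₂, hK hv₁ hv₂ (by positivity) (by positivity) ?_, ?_⟩
    · rw [← add_div, div_self h0.ne']
    · rw [smul_sub (a * t₁ + b * t₂), smul_add, smul_smul (a * t₁ + b * t₂),
        smul_smul (a * t₁ + b * t₂), mul_div_cancel₀ _ h0.ne', mul_div_cancel₀ _ h0.ne']
      module

/-- The pathwise oracle inequality for the projection onto a convex set. -/
theorem IsNearestPoint.norm_sub_sq_le (hK : Convex ℝ K) (hu : u ∈ K)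
    {μ z p : EuclideanSpace ℝ (Fin n)} (hp : IsNearestPoint K (μ + z) p) :
    ‖p - μ‖ ^ 2 ≤ ‖u - μ‖ ^ 2 + ‖convexProj (closedTangentCone K u) z‖ ^ 2 := by
  have h1 := hp.inner_sub_sub_nonpos hK hu
  have h2 := two_mul_inner_sub_norm_sq_le isClosed_closure (convex_closedTangentCone hK)
    smul_mem_closedTangentCone z (sub_mem_closedTangentCone (u := u) hp.1)
  have h3 : ‖p - μ‖ ^ 2 = ‖u - μ‖ ^ 2 + (2 * ⟪z, p - u⟫ - ‖p - u‖ ^ 2) +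
      2 * ⟪μ + z - p, u - p⟫ := by
    simp only [← real_inner_self_eq_norm_sq, inner_sub_left, inner_sub_right, inner_add_left,
      real_inner_comm u p, real_inner_comm μ p, real_inner_comm μ u]
    ring
  linarith!

end TangentCone

/-! ### Statistical dimension -/

theorem multivariateGaussian_smul_one {n : ℕ} (σ : ℝ) :
    multivariateGaussian (0 : EuclideanSpace ℝ (Fin n)) (σ ^ 2 • (1 : Matrix (Fin n) (Fin n) ℝ)) =
      (multivariateGaussian (0 : EuclideanSpace ℝ (Fin n)) 1).map (fun g => σ • g) := by
  apply Measure.ext_of_charFun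
  ext x
  rw [charFun_map_smul, charFun_multivariateGaussian Matrix.PosSemidef.one,
    charFun_multivariateGaussian (Matrix.PosSemidef.one.smul (sq_nonneg σ))]
  simp [Matrix.smul_mulVec]
  ring_nf

section StatDim

variable {n : ℕ} {C : Set (EuclideanSpace ℝ (Fin n))}

theorem statDim_nonneg : 0 ≤ statDim C := integral_nonneg fun _ => sq_nonneg _

theorem memLp_norm_convexProj (hne : C.Nonempty) (hcl : IsClosed C) (hconv : Convex ℝ C)
    (hcone : ∀ s : ℝ, 0 ≤ s → ∀ w ∈ C, s • w ∈ C) :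
    MemLp (fun g => ‖convexProj C g‖) 2
      (multivariateGaussian (0 : EuclideanSpace ℝ (Fin n)) 1) := by
  have h : MemLp id 2 (multivariateGaussian (0 : EuclideanSpace ℝ (Fin n)) 1) :=
    IsGaussian.memLp_two_id
  refine MemLp.of_le h
    (lipschitzWith_convexProj hne hcl hconv).continuous.norm.aestronglyMeasurable ?_
  refine Filter.Eventually.of_forall fun g => ?_
  simpa using norm_convexProj_le hne hcl hconv hcone g

theorem integrable_norm_convexProj_sq (hne : C.Nonempty) (hcl : IsClosed C) (hconv : Convex ℝ C)
    (hcone : ∀ s : ℝ, 0 ≤ s → ∀ w ∈ C, s • w ∈ C) :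
    Integrable (fun g => ‖convexProj C g‖ ^ 2)
      (multivariateGaussian (0 : EuclideanSpace ℝ (Fin n)) 1) :=
  (memLp_norm_convexProj hne hcl hconv hcone).integrable_sq

/-- Jensen's inequality, in the form of nonnegative variance. -/
theorem integral_norm_convexProj_le (hne : C.Nonempty) (hcl : IsClosed C) (hconv : Convex ℝ C)
    (hcone : ∀ s : ℝ, 0 ≤ s → ∀ w ∈ C, s • w ∈ C) :
    ∫ g, ‖convexProj C g‖ ∂(multivariateGaussian (0 : EuclideanSpace ℝ (Fin n)) 1) ≤
      √(statDim C) := by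
  refine Real.le_sqrt_of_sq_le ?_
  have h := variance_eq_sub (memLp_norm_convexProj hne hcl hconv hcone)
  have h0 := variance_nonneg (fun g => ‖convexProj C g‖)
    (multivariateGaussian (0 : EuclideanSpace ℝ (Fin n)) 1)
  rw [h] at h0
  exact sub_nonneg.1 h0

theorem multivariateGaussian_real_sqrt_statDim_add_le (hne : C.Nonempty) (hcl : IsClosed C) (hconv : Convex ℝ C)
    (hcone : ∀ s : ℝ, 0 ≤ s → ∀ w ∈ C, s • w ∈ C)
    {x : ℝ} (hx : 0 ≤ x) :
    (multivariateGaussian (0 : EuclideanSpace ℝ (Fin n)) 1).real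
      {g | √(statDim C) + √(2 * x) ≤ ‖convexProj C g‖} ≤ Real.exp (-x) := by
  have hl : LipschitzWith 1 fun g => ‖convexProj C g‖ := by
    simpa [Function.comp_def] using
      lipschitzWith_one_norm.comp (lipschitzWith_convexProj hne hcl hconv)
  have hi := (memLp_norm_convexProj hne hcl hconv hcone).integrable one_le_two
  have hm := integral_norm_convexProj_le hne hcl hconv hcone
  rw [multivariateGaussian_zero_one] at hi hm ⊢
  refine (stdGaussian_real_ge_le_of_lipschitz hl (fun _ => norm_nonneg _) hi hm
    (Real.sqrt_nonneg _)).trans_eq ?_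
  rw [Real.sq_sqrt (by positivity), mul_div_cancel_left₀ _ two_ne_zero]

end StatDim

/-! ### The oracle inequalities -/

theorem mainTheorem3 {n : ℕ} (hn : 1 ≤ n)
    {Ω : Type*} [MeasurableSpace Ω] (P : Measure Ω) [IsProbabilityMeasure P]
    (σ : ℝ) (hσ : 0 < σ)
    (μ : EuclideanSpace ℝ (Fin n))
    (K : Set (EuclideanSpace ℝ (Fin n))) (hKclosed : IsClosed K) (hKconvex : Convex ℝ K)
    (u : EuclideanSpace ℝ (Fin n)) (hu : u ∈ K)
    (ξ : Ω → EuclideanSpace ℝ (Fin n))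
    (hξ : HasLaw ξ (multivariateGaussian (0 : EuclideanSpace ℝ (Fin n))
      (σ ^ 2 • (1 : Matrix (Fin n) (Fin n) ℝ))) P)
    (muHat : Ω → EuclideanSpace ℝ (Fin n))
    (hmuHat : ∀ ω, IsLeastSquares K (μ + ξ ω) (muHat ω)) :
    (Integrable (fun ω => scaledNormSq (muHat ω - μ)) P ∧
      ∫ ω, scaledNormSq (muHat ω - μ) ∂P ≤
        scaledNormSq (u - μ) + σ ^ 2 / n * statDim (closedTangentCone K u)) ∧
    (∀ x : ℝ, 0 < x →
      1 - Real.exp (-x) ≤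
        P.real {ω | scaledNormSq (muHat ω - μ) - scaledNormSq (u - μ) ≤
          σ ^ 2 / n * (√(statDim (closedTangentCone K u)) + √(2 * x)) ^ 2} ∧
      σ ^ 2 / n * (√(statDim (closedTangentCone K u)) + √(2 * x)) ^ 2 ≤
        σ ^ 2 / n * (2 * statDim (closedTangentCone K u) + 4 * x)) := by
  have hn' : (0 : ℝ) < 1 / n := one_div_pos.2 (Nat.cast_pos.2 hn)
  set T := closedTangentCone K u with hT
  set γ := multivariateGaussian (0 : EuclideanSpace ℝ (Fin n)) 1 with hγ
  have hne : T.Nonempty := ⟨_, sub_mem_closedTangentCone hu⟩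
  have hcl : IsClosed T := isClosed_closure
  have hconv : Convex ℝ T := convex_closedTangentCone hKconvex
  have hcone : ∀ s : ℝ, 0 ≤ s → ∀ w ∈ T, s • w ∈ T := smul_mem_closedTangentCone
  have hcont : Continuous (convexProj T) := (lipschitzWith_convexProj hne hcl hconv).continuous
  have hlaw : P.map ξ = γ.map (fun g => σ • g) := by
    rw [hξ.map_eq, multivariateGaussian_smul_one]
  have hproj : ∀ g, ‖convexProj T (σ • g)‖ = σ * ‖convexProj T g‖ := fun g => by
    rw [convexProj_smul hne hcl hconv hcone hσ, norm_smul, Real.norm_of_nonneg hσ.le]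
  have hnear : ∀ ω, IsNearestPoint K (μ + ξ ω) (muHat ω) := fun ω => (hmuHat ω).isNearestPoint hn
  have hpath : ∀ ω, scaledNormSq (muHat ω - μ) ≤
      scaledNormSq (u - μ) + 1 / n * ‖convexProj T (ξ ω)‖ ^ 2 := fun ω => by
    rw [scaledNormSq_eq, scaledNormSq_eq, ← mul_add]
    exact mul_le_mul_of_nonneg_left ((hnear ω).norm_sub_sq_le hKconvex hu) hn'.le
  have hcsq : Continuous fun z => ‖convexProj T z‖ ^ 2 := hcont.norm.pow 2
  have hint : Integrable (fun ω => ‖convexProj T (ξ ω)‖ ^ 2) P := by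
    change Integrable ((fun z => ‖convexProj T z‖ ^ 2) ∘ ξ) P
    rw [← integrable_map_measure hcsq.aestronglyMeasurable hξ.aemeasurable, hlaw,
      integrable_map_measure hcsq.aestronglyMeasurable (by fun_prop)]
    simp only [Function.comp_def, hproj, mul_pow]
    exact (integrable_norm_convexProj_sq hne hcl hconv hcone).const_mul _
  have hval : ∫ ω, ‖convexProj T (ξ ω)‖ ^ 2 ∂P = σ ^ 2 * statDim T := by
    rw [← integral_map (f := fun z => ‖convexProj T z‖ ^ 2) hξ.aemeasurable
      hcsq.aestronglyMeasurable, hlaw, integral_map (by fun_prop) hcsq.aestronglyMeasurable]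
    simp only [hproj, mul_pow]
    rw [integral_const_mul, statDim]
  -- Measurability of `muHat` is not assumed; uniqueness of the nearest point makes it a continuous
  -- function of `ξ`.
  have hmeas : AEStronglyMeasurable (fun ω => scaledNormSq (muHat ω - μ)) P := by
    have e : (fun ω => scaledNormSq (muHat ω - μ)) =
        (fun z => 1 / (n : ℝ) * ‖convexProj K (μ + z) - μ‖ ^ 2) ∘ ξ := by
      ext ω
      rw [scaledNormSq_eq, (hnear ω).eq_convexProj hKclosed hKconvex, Function.comp_apply]
    have hK := (lipschitzWith_convexProj ⟨u, hu⟩ hKclosed hKconvex).continuous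
    have hc : Continuous fun z => 1 / (n : ℝ) * ‖convexProj K (μ + z) - μ‖ ^ 2 := by fun_prop
    rw [e]
    exact (hc.measurable.comp_aemeasurable hξ.aemeasurable).aestronglyMeasurable
  have hdom : Integrable
      (fun ω => scaledNormSq (u - μ) + 1 / n * ‖convexProj T (ξ ω)‖ ^ 2) P :=
    (integrable_const _).add (hint.const_mul _)
  have hI : Integrable (fun ω => scaledNormSq (muHat ω - μ)) P := by
    refine hdom.mono' hmeas (Filter.Eventually.of_forall fun ω => ?_)
    rw [Real.norm_of_nonneg (by rw [scaledNormSq_eq]; positivity)]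
    exact hpath ω
  refine ⟨⟨hI, ?_⟩, fun x hx => ⟨?_, ?_⟩⟩
  · refine (integral_mono hI hdom hpath).trans_eq ?_
    rw [integral_add (integrable_const _) (hint.const_mul _), integral_const_mul, hval]
    simp
    ring
  · set r := √(statDim T) + √(2 * x)
    have hr : 0 ≤ r := by positivity
    have hA : MeasurableSet {z | ‖convexProj T z‖ < σ * r} :=
      measurableSet_lt hcont.norm.measurable measurable_const
    have hB : MeasurableSet {g | r ≤ ‖convexProj T g‖} :=
      measurableSet_le measurable_const hcont.norm.measurable
    have h1 : P.real (ξ ⁻¹' {z | ‖convexProj T z‖ < σ * r}) =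
        1 - γ.real {g | r ≤ ‖convexProj T g‖} := by
      rw [← probReal_compl_eq_one_sub hB, measureReal_def, measureReal_def,
        ← Measure.map_apply_of_aemeasurable hξ.aemeasurable hA, hlaw,
        Measure.map_apply (by fun_prop) hA]
      congr 2
      ext g
      simp [hproj, hσ]
    have h2 := multivariateGaussian_real_sqrt_statDim_add_le hne hcl hconv hcone hx.le
    refine le_trans (by rw [h1]; exact sub_le_sub_left h2 1) (measureReal_mono fun ω hω => ?_)
    have h3 := pow_le_pow_left₀ (norm_nonneg _) (le_of_lt (show _ < _ from hω)) 2
    have h4 := mul_le_mul_of_nonneg_left h3 hn'.le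
    have e : σ ^ 2 / n * r ^ 2 = 1 / n * (σ * r) ^ 2 := by ring
    change scaledNormSq (muHat ω - μ) - scaledNormSq (u - μ) ≤ σ ^ 2 / n * r ^ 2
    rw [e]
    linarith [hpath ω]
  · have h1 := Real.sq_sqrt (statDim_nonneg (C := T))
    have h2 := Real.sq_sqrt (by positivity : (0 : ℝ) ≤ 2 * x)
    refine mul_le_mul_of_nonneg_left ?_ (by positivity)
    -- `(a + b)² ≤ 2a² + 2b²`, with `b² = 2x`.
    nlinarith [sq_nonneg (√(statDim T) - √(2 * x))]
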